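/- Let $\lambda>0$ and let $\mathcal L$ be a probability measure on $\mathbb R_+=[0,\infty)$ with finite mean that puts no mass on the maximum of its support (if this maximum exists). Put $S=\sup\operatorname{supp}(\mathcal L)\in(0,\infty]$. Let $L=\{(x_i,h_i)\}_{i\in\mathbb N}\subset\mathbb R\times\mathbb R_+$ be a Poisson building process of intensity $\lambda$ and height distribution $\mathcal L$: the bases $x_i$ form a homogeneous Poisson point process of intensity $\lambda$ on $\mathbb R$, and the heights $h_i$ are i.i.d. marks of law $\mathcal L$, independent of the bases. For a point $(x,y)\in\mathbb R\times\mathbb R_+$, the blocking building of $(x,y)$ is $$\tau(x,y)=\operatorname*{argmax}_{(a,b)\in L,\ a>x}\ \frac{b-y}{a-x},$$ and it is well defined when this maximum is reached at exactly one building. Let $(X_0,H_0)$ be a random point of $\mathbb R\times\mathbb R_+$, of arbitrary law, independent of $L$, with $H_0<S$ almost surely; let $(X_n,H_n)=\tau^{(n)}(X_0,H_0)$ for $n\ge 0$ be the sequence of successive blocking buildings and, for $n\ge1$, let $$t_n=\frac{H_n-H_{n-1}}{X_n-X_{n-1}}$$ be the blockage slopes. Then, almost surely, all the blocking buildings $(X_n,H_n)$,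 $n\ge1$, are well defined, $H_n\to S$ and $t_n\to0$ as $n\to\infty$. -/

import Mathlib

open MeasureTheory ProbabilityTheory Filter Topology
open scoped NNReal ENNReal

noncomputable section

/-- The half plane `ℝ × ℝ₊`. A landscape is a set of points of the half plane; the point `(x, h)` of
a landscape is the (top of the) building with base `x` and height `h`. -/
abbrev HalfPlane : Type := ℝ × ℝ≥0

/-- The slope `(b - y) / (a - x)` of the line from `(x, y)` to `(a, b)`. -/
def slopeBetween (p q : HalfPlane) : ℝ := ((q.2 : ℝ) - (p.2 : ℝ)) / (q.1 - p.1)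

/-- `b` is the blocking building of `p` in the landscape `L`: it is the one and only point at which
the maximum of the slopes from `p` to the buildings of `L` strictly to the right of `p` is reached. -/
def IsBlockingBuilding (L : Set HalfPlane) (p b : HalfPlane) : Prop :=
  b ∈ L ∧ p.1 < b.1 ∧
    ∀ c ∈ L, p.1 < c.1 → c ≠ b → slopeBetween p c < slopeBetween p b

open Classical in
/-- The blocking building `τ(p, L)`, with the value `p` when it is not well defined. -/
def blockingBuilding (L : Set HalfPlane) (p : HalfPlane) : HalfPlane :=
  if h : ∃ b, IsBlockingBuilding L p b then h.choose else p

/-- The blockage sequence `(X_n, H_n) = τ^(n)(p, L)`. -/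
def blockageSeq (L : Set HalfPlane) (p : HalfPlane) (n : ℕ) : HalfPlane :=
  (blockingBuilding L)^[n] p

/-- The blocking heights `H_n`. -/
def blockageHeight (L : Set HalfPlane) (p : HalfPlane) (n : ℕ) : ℝ≥0 :=
  (blockageSeq L p n).2

/-- The blockage slopes: the value at `n` is the slope from `(X_n, H_n)` to
`(X_{n+1}, H_{n+1})`, that is, `t_{n+1}` in the numbering `t_1, t_2, …`. -/
def blockageSlopeSeq (L : Set HalfPlane) (p : HalfPlane) (n : ℕ) : ℝ :=
  slopeBetween (blockageSeq L p n) (blockageSeq L p (n + 1))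

section Random

variable {Ω : Type*} [MeasurableSpace Ω]

/-- The number of points of `X_0, X_1, …` in the set `B`. -/
def pointCount (X : ℕ → Ω → ℝ) (B : Set ℝ) (ω : Ω) : ℕ∞ := {i : ℕ | X i ω ∈ B}.encard

/-- The random variables `X_0, X_1, …` enumerate, without repetition, the points of a homogeneous
Poisson point process of intensity `lam` on the line: the number of points in a Borel set `B` of
finite Lebesgue measure has the Poisson law with mean `lam * |B|`, and the numbers of points in
finitely many pairwise disjoint Borel sets are independent. -/
structure IsPoissonPointProcess (X : ℕ → Ω → ℝ) (lam : ℝ≥0) (P : Measure Ω) : Prop where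
  measurable : ∀ i, Measurable (X i)
  injective : ∀ᵐ ω ∂P, Function.Injective fun i => X i ω
  count_law : ∀ B : Set ℝ, MeasurableSet B → volume B < ∞ →
    HasLaw (pointCount X B) ((poissonMeasure (lam * (volume B).toNNReal)).map ((↑) : ℕ → ℕ∞)) P
  count_indep : ∀ (m : ℕ) (B : Fin m → Set ℝ), (∀ j, MeasurableSet (B j)) →
    Pairwise (Function.onFun Disjoint B) → iIndepFun (fun j => pointCount X (B j)) P

/-- The buildings `(X_i, M_i)` form a Poisson building process with intensity `lam` and height
distribution `𝓛`: the bases are a Poisson point process of intensity `lam`, and its marks, the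
heights `M_i`, are i.i.d. with law `𝓛` and independent of the bases. -/
structure IsPoissonBuildingProcess (X : ℕ → Ω → ℝ) (M : ℕ → Ω → ℝ≥0) (lam : ℝ≥0)
    (𝓛 : Measure ℝ≥0) (P : Measure Ω) : Prop where
  bases : IsPoissonPointProcess X lam P
  measurable : ∀ i, Measurable (M i)
  marks_law : ∀ i, HasLaw (M i) 𝓛 P
  marks_indep : iIndepFun M P
  marks_indep_bases : IndepFun (fun ω i => X i ω) (fun ω i => M i ω) P

/-- The random landscape `{(X_i, M_i)}`. -/
def landscape (X : ℕ → Ω → ℝ) (M : ℕ → Ω → ℝ≥0) (ω : Ω) : Set HalfPlane :=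
  Set.range fun i => (X i ω, M i ω)

end Random

/-- The supremum in `[0, ∞]` of the support of a height distribution. -/
def heightSup (𝓛 : Measure ℝ≥0) : ℝ≥0∞ := ⨆ h ∈ 𝓛.support, (h : ℝ≥0∞)

end

/-! The probability is confined to `IsGenericLandscape` and the absence of ties seen from the
starting point; the rest is deterministic. Below height `S` some building is seen under a positive
slope, and only finitely many slopes exceed a positive threshold, so the maximum is attained and
positive; without ties it is attained once. Ties at slope zero must be tolerated, since `𝓛` may have
atoms, and are harmless because the maximum is positive. Local finiteness sends the bases to
infinity. If the heights stayed below some `r < S`, a building higher than `r` on the right could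
never be passed. The slopes decrease, and a positive lower bound would place infinitely many
blocking buildings above one line of positive slope. Almost surely, the finite mean leaves finitely
many buildings above such a line (`ae_finite_slope_ge`), and independent marks give high buildings
arbitrarily far out (`ae_exists_high`). A tie is an affine relation between bases with coefficients
depending on the heights; with these frozen by independence, it has probability zero
(`ae_ne_affine`). -/

/-! ### Deterministic landscapes -/

/-- From `p`, two distinct buildings of `L` are never seen under the same nonzero slope. -/
def NoSlopeTie (L : Set HalfPlane) (p : HalfPlane) : Prop :=
  ∀ c ∈ L, ∀ d ∈ L, p.1 < c.1 → p.1 < d.1 → c ≠ d → slopeBetween p c = slopeBetween p d →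
    slopeBetween p c = 0

/-- The properties, almost surely true of a Poisson building process, that make all blocking
buildings well defined and drive the blocking heights to `S`. -/
structure IsGenericLandscape (L : Set HalfPlane) (S : ℝ≥0∞) : Prop where
  finite_slope_ge : ∀ (p : HalfPlane) (δ : ℝ), 0 < δ →
    {c | c ∈ L ∧ p.1 < c.1 ∧ δ ≤ slopeBetween p c}.Finite
  finite_base_mem : ∀ a b : ℝ, {c | c ∈ L ∧ a ≤ c.1 ∧ c.1 ≤ b}.Finite
  exists_high : ∀ r : ℝ≥0, (r : ℝ≥0∞) < S → ∀ a : ℝ, ∃ c ∈ L, a < c.1 ∧ r < c.2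
  height_lt : ∀ c ∈ L, (c.2 : ℝ≥0∞) < S
  noSlopeTie : ∀ p ∈ L, NoSlopeTie L p

namespace IsBlockingBuilding

variable {L : Set HalfPlane} {p b c : HalfPlane}

theorem eq (hb : IsBlockingBuilding L p b) (hc : IsBlockingBuilding L p c) : b = c := by
  by_contra h
  exact lt_asymm (hb.2.2 c hc.1 hc.2.1 (Ne.symm h)) (hc.2.2 b hb.1 hb.2.1 h)

theorem blockingBuilding_eq (hb : IsBlockingBuilding L p b) : blockingBuilding L p = b := by
  have h : ∃ b, IsBlockingBuilding L p b := ⟨b, hb⟩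
  rw [blockingBuilding, dif_pos h]
  exact h.choose_spec.eq hb

end IsBlockingBuilding

theorem slopeBetween_pos_iff {p c : HalfPlane} (h : p.1 < c.1) :
    0 < slopeBetween p c ↔ p.2 < c.2 := by
  rw [slopeBetween, div_pos_iff_of_pos_right (sub_pos.2 h), sub_pos, NNReal.coe_lt_coe]

theorem slopeBetween_mul {p c : HalfPlane} (h : p.1 < c.1) :
    slopeBetween p c * (c.1 - p.1) = c.2 - p.2 :=
  div_mul_cancel₀ _ (sub_pos.2 h).ne'

theorem IsGenericLandscape.exists_isBlockingBuilding {L : Set HalfPlane} {S : ℝ≥0∞}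
    (hL : IsGenericLandscape L S) {p : HalfPlane} (hp : (p.2 : ℝ≥0∞) < S) (ht : NoSlopeTie L p) :
    ∃ b, IsBlockingBuilding L p b ∧ p.2 < b.2 := by
  obtain ⟨c, hcL, hc1, hc2⟩ := hL.exists_high p.2 hp p.1
  have hδ : 0 < slopeBetween p c := (slopeBetween_pos_iff hc1).2 hc2
  obtain ⟨b, ⟨hbL, hb1, hbc⟩, hmax⟩ :=
    Set.exists_max_image _ (slopeBetween p) (hL.finite_slope_ge p _ hδ) ⟨c, hcL, hc1, le_rfl⟩
  have hb0 := hδ.trans_le hbc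
  refine ⟨b, ⟨hbL, hb1, fun d hdL hd1 hdb => ?_⟩, (slopeBetween_pos_iff hb1).1 hb0⟩
  -- Buildings seen under a smaller slope than `c` lie outside the finite set but lose to `b`
  -- anyway.
  by_cases h : slopeBetween p c ≤ slopeBetween p d
  · refine lt_of_le_of_ne (hmax d ⟨hdL, hd1, h⟩) fun he => hb0.ne' ?_
    exact ht b hbL d hdL hb1 hd1 hdb.symm he.symm
  · exact (not_le.1 h).trans_le hbc

theorem IsGenericLandscape.blockageSeq_spec {L : Set HalfPlane} {S : ℝ≥0∞}
    (hL : IsGenericLandscape L S) {p : HalfPlane} (hp : (p.2 : ℝ≥0∞) < S) (ht : NoSlopeTie L p)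
    (n : ℕ) :
    IsBlockingBuilding L (blockageSeq L p n) (blockageSeq L p (n + 1)) ∧
      (blockageSeq L p n).2 < (blockageSeq L p (n + 1)).2 := by
  have key : ∀ n, ((blockageSeq L p n).2 : ℝ≥0∞) < S ∧ NoSlopeTie L (blockageSeq L p n) →
      IsBlockingBuilding L (blockageSeq L p n) (blockageSeq L p (n + 1)) ∧
      (blockageSeq L p n).2 < (blockageSeq L p (n + 1)).2 := by
    rintro n ⟨h1, h2⟩
    obtain ⟨b, hb, hlt⟩ := hL.exists_isBlockingBuilding h1 h2
    have : blockageSeq L p (n + 1) = b := by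
      rw [blockageSeq, Function.iterate_succ_apply']
      exact hb.blockingBuilding_eq
    exact this ▸ ⟨hb, hlt⟩
  refine key n ?_
  induction n with
  | zero => exact ⟨hp, ht⟩
  | succ n ih =>
    have h := (key n ih).1.1
    exact ⟨hL.height_lt _ h, hL.noSlopeTie _ h⟩

section Sequence

variable {L : Set HalfPlane} {S : ℝ≥0∞} {q : ℕ → HalfPlane}

theorem strictMono_base (hq : ∀ n, IsBlockingBuilding L (q n) (q (n + 1))) :
    StrictMono fun n => (q n).1 :=
  strictMono_nat_of_lt_succ fun n => (hq n).2.1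

theorem IsGenericLandscape.tendsto_base (hL : IsGenericLandscape L S)
    (hq : ∀ n, IsBlockingBuilding L (q n) (q (n + 1))) :
    Tendsto (fun n => (q n).1) atTop atTop := by
  have hmono := strictMono_base hq
  refine tendsto_atTop_atTop_of_monotone hmono.monotone fun B => ?_
  by_contra! h
  refine Set.infinite_of_injective_forall_mem (f := fun n => q (n + 1))
    (fun m n hmn => ?_) (fun n => ?_) (hL.finite_base_mem (q 0).1 B)
  · exact Nat.succ_injective (hmono.injective (congrArg Prod.fst hmn))
  · exact ⟨(hq n).1, hmono.monotone (Nat.zero_le _), (h _).le⟩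

theorem IsGenericLandscape.tendsto_height (hL : IsGenericLandscape L S)
    (hq : ∀ n, IsBlockingBuilding L (q n) (q (n + 1))) (hmono : Monotone fun n => (q n).2)
    (h0 : ((q 0).2 : ℝ≥0∞) < S) : Tendsto (fun n => ((q n).2 : ℝ≥0∞)) atTop (𝓝 S) := by
  have hlt : ∀ n, ((q n).2 : ℝ≥0∞) < S := by
    rintro (_ | n)
    · exact h0
    · exact hL.height_lt _ (hq n).1
  have hmono' : Monotone fun n => ((q n).2 : ℝ≥0∞) := fun m n h =>
    ENNReal.coe_le_coe.2 (hmono h)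
  refine tendsto_order.2 ⟨fun r hr => ?_, fun r hr => Eventually.of_forall fun n => (hlt n).trans hr⟩
  lift r to ℝ≥0 using (hr.trans_le le_top).ne
  suffices ∃ n, (r : ℝ≥0∞) < (q n).2 by
    obtain ⟨n, hn⟩ := this
    filter_upwards [eventually_ge_atTop n] with m hm using hn.trans_le (hmono' hm)
  by_contra! h
  obtain ⟨c, hcL, hc1, hc2⟩ := hL.exists_high r hr (q 0).1
  have hle : ∀ n, (q n).2 ≤ r := fun n => by exact_mod_cast h n
  have hbase : ∀ n, (q n).1 < c.1 := by
    intro n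
    induction n with
    | zero => exact hc1
    | succ n ih =>
      have hne : c ≠ q (n + 1) := fun e => (hle (n + 1)).not_gt (e ▸ hc2)
      have hslope := (hq n).2.2 c hcL ih hne
      -- Past `c`, a steeper slope over a longer distance would make `q (n + 1)` at least as high as
      -- `c`, hence higher than `r`.
      by_contra! hge
      have e1 := slopeBetween_mul ih
      have e2 := slopeBetween_mul (hq n).2.1
      have hpos := (slopeBetween_pos_iff ih).2 ((hle n).trans_lt hc2)
      have h3 : ((q (n + 1)).2 : ℝ) < c.2 := NNReal.coe_lt_coe.2 ((hle _).trans_lt hc2)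
      have h4 : slopeBetween (q n) c * (c.1 - (q n).1) ≤
          slopeBetween (q n) (q (n + 1)) * ((q (n + 1)).1 - (q n).1) :=
        mul_le_mul hslope.le (by linarith) (by linarith) (hpos.trans hslope).le
      linarith
  obtain ⟨n, hn⟩ := ((hL.tendsto_base hq).eventually_ge_atTop c.1).exists
  exact (hbase n).not_ge hn

/-- The slope from `q n` to `q (n + 2)` is a weighted mean of the two successive slopes and is less
than the first, so the second is smaller too. -/
theorem antitone_slope (hq : ∀ n, IsBlockingBuilding L (q n) (q (n + 1))) :
    Antitone fun n => slopeBetween (q n) (q (n + 1)) := by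
  refine antitone_nat_of_succ_le fun n => ?_
  have h1 := (hq n).2.1
  have h2 := (hq (n + 1)).2.1
  have hslope := (hq n).2.2 _ (hq (n + 1)).1 (h1.trans h2) fun e => h2.ne (congrArg Prod.fst e).symm
  have e1 := slopeBetween_mul h1
  have e2 := slopeBetween_mul h2
  have e3 := slopeBetween_mul (h1.trans h2)
  have h3 := mul_lt_mul_of_pos_right hslope (sub_pos.2 (h1.trans h2))
  refine le_of_mul_le_mul_right ?_ (sub_pos.2 h2)
  nlinarith

theorem IsGenericLandscape.tendsto_slope (hL : IsGenericLandscape L S)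
    (hq : ∀ n, IsBlockingBuilding L (q n) (q (n + 1))) (hmono : Monotone fun n => (q n).2) :
    Tendsto (fun n => slopeBetween (q n) (q (n + 1))) atTop (𝓝 0) := by
  have hanti := antitone_slope hq
  have hbase := strictMono_base hq
  have hnonneg : ∀ n, 0 ≤ slopeBetween (q n) (q (n + 1)) := fun n =>
    div_nonneg (sub_nonneg.2 (NNReal.coe_le_coe.2 (hmono n.le_succ)))
      (sub_nonneg.2 (hq n).2.1.le)
  refine tendsto_order.2 ⟨fun r hr => Eventually.of_forall fun n => hr.trans_le (hnonneg n),
    fun δ hδ => ?_⟩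
  suffices ∃ n, slopeBetween (q n) (q (n + 1)) < δ by
    obtain ⟨n, hn⟩ := this
    filter_upwards [eventually_ge_atTop n] with m hm using (hanti hm).trans_lt hn
  by_contra! h
  -- Steps of slope at least `δ` keep the whole sequence above the line of slope `δ` through `q 0`.
  have hline : ∀ n, δ * ((q n).1 - (q 0).1) ≤ (q n).2 - (q 0).2 := by
    intro n
    induction n with
    | zero => simp
    | succ n ih =>
      have e := slopeBetween_mul (hq n).2.1
      have := mul_le_mul_of_nonneg_right (h n) (sub_pos.2 (hq n).2.1).le
      nlinarith
  refine Set.infinite_of_injective_forall_mem (f := fun n => q (n + 1))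
    (fun m n hmn => ?_) (fun n => ?_) (hL.finite_slope_ge (q 0) δ hδ)
  · exact Nat.succ_injective (hbase.injective (congrArg Prod.fst hmn))
  · have h0 : (q 0).1 < (q (n + 1)).1 := hbase n.succ_pos
    exact ⟨(hq n).1, h0, (le_div_iff₀ (sub_pos.2 h0)).2 (hline _)⟩

end Sequence

theorem IsGenericLandscape.blockage {L : Set HalfPlane} {S : ℝ≥0∞}
    (hL : IsGenericLandscape L S) {p : HalfPlane} (hp : (p.2 : ℝ≥0∞) < S) (ht : NoSlopeTie L p) :
    (∀ n, IsBlockingBuilding L (blockageSeq L p n) (blockageSeq L p (n + 1))) ∧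
      Tendsto (fun n => (blockageHeight L p n : ℝ≥0∞)) atTop (𝓝 S) ∧
      Tendsto (blockageSlopeSeq L p) atTop (𝓝 0) := by
  have hq := fun n => (hL.blockageSeq_spec hp ht n).1
  have hmono : Monotone fun n => (blockageSeq L p n).2 :=
    monotone_nat_of_le_succ fun n => (hL.blockageSeq_spec hp ht n).2.le
  exact ⟨hq, hL.tendsto_height hq hmono hp, hL.tendsto_slope hq hmono⟩

/-! ### Moments and independence of Poisson counts -/

theorem lintegral_natCast_poissonMeasure (r : ℝ≥0) :
    ∫⁻ n, (n : ℝ≥0∞) ∂(poissonMeasure r) = r := by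
  have hstep : ∀ n : ℕ, ((n + 1 : ℕ) : ℝ≥0∞) * poissonMeasure r {n + 1} =
      r * poissonMeasure r {n} := by
    intro n
    rw [poissonMeasure_singleton, poissonMeasure_singleton, ← ENNReal.ofReal_natCast,
      ← ENNReal.ofReal_coe_nnreal, ← ENNReal.ofReal_mul (by positivity),
      ← ENNReal.ofReal_mul (by positivity)]
    congr 1
    rw [Nat.factorial_succ]
    push_cast
    field_simp
    ring
  rw [lintegral_countable', tsum_eq_zero_add' ENNReal.summable]
  simp only [hstep, Nat.cast_zero, zero_mul, zero_add]
  rw [ENNReal.tsum_mul_left]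
  have := measure_iUnion (μ := poissonMeasure r) (f := fun n : ℕ => {n})
    (fun i j hij => by simpa using hij) (fun n => measurableSet_singleton n)
  rw [← this, Set.iUnion_singleton_eq_range, Set.range_id', measure_univ, mul_one]

theorem pointCount_ne_zero_iff {Ω : Type*} {X : ℕ → Ω → ℝ} {B : Set ℝ} {ω : Ω} :
    pointCount X B ω ∈ ({0}ᶜ : Set ℕ∞) ↔ ∃ i, X i ω ∈ B := by
  simp [pointCount, Set.encard_eq_zero, ← Set.nonempty_iff_ne_empty, Set.Nonempty]

namespace IsPoissonPointProcess

variable {Ω : Type*} [MeasurableSpace Ω] {P : Measure Ω} {X : ℕ → Ω → ℝ} {lam : ℝ≥0}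

/-- The count is a sum of indicators, so its Poisson mean is the sum of the probabilities. The
individual laws of the `X i` depend on the enumeration and are unknown; only such sums are
accessible. -/
theorem tsum_measure_preimage (h : IsPoissonPointProcess X lam P) {B : Set ℝ}
    (hB : MeasurableSet B) (hB' : volume B < ∞) :
    ∑' i, P (X i ⁻¹' B) = lam * volume B := by
  have hlaw := h.count_law B hB hB'
  have hcount : ∀ ω, ∑' i, (X i ⁻¹' B).indicator (fun _ => (1 : ℝ≥0∞)) ω =
      (pointCount X B ω : ℝ≥0∞) := by
    intro ω
    rw [pointCount, ← ENNReal.tsum_set_one,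
      tsum_subtype {i : ℕ | X i ω ∈ B} (fun _ => (1 : ℝ≥0∞))]
    rfl
  calc ∑' i, P (X i ⁻¹' B)
      = ∑' i, ∫⁻ ω, (X i ⁻¹' B).indicator (fun _ => (1 : ℝ≥0∞)) ω ∂P := by
        congr with i
        rw [lintegral_indicator_const (h.measurable i hB), one_mul]
    _ = ∫⁻ ω, (pointCount X B ω : ℝ≥0∞) ∂P := by
        rw [← lintegral_tsum fun i =>
          (measurable_const.indicator (h.measurable i hB)).aemeasurable]
        exact lintegral_congr hcount
    _ = ∫⁻ n, (n : ℝ≥0∞) ∂(P.map (pointCount X B)) :=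
        (lintegral_map' (f := fun n : ℕ∞ => (n : ℝ≥0∞))
          (Measurable.of_discrete).aemeasurable hlaw.aemeasurable).symm
    _ = lam * volume B := by
        rw [hlaw.map_eq, lintegral_map Measurable.of_discrete Measurable.of_discrete]
        simp only [ENat.toENNReal_coe]
        rw [lintegral_natCast_poissonMeasure, ENNReal.coe_mul, ENNReal.coe_toNNReal hB'.ne]

theorem ae_finite_mem (h : IsPoissonPointProcess X lam P) {B : Set ℝ}
    (hB : MeasurableSet B) (hB' : volume B < ∞) : ∀ᵐ ω ∂P, {i | X i ω ∈ B}.Finite := by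
  refine ae_finite_setOfPred_mem (s := fun i => X i ⁻¹' B) ?_
  rw [h.tsum_measure_preimage hB hB']
  exact ENNReal.mul_ne_top ENNReal.coe_ne_top hB'.ne

theorem measure_exists_mem_le (h : IsPoissonPointProcess X lam P) {B : Set ℝ}
    (hB : MeasurableSet B) (hB' : volume B < ∞) :
    P {ω | ∃ i, X i ω ∈ B} ≤ lam * volume B := by
  rw [← h.tsum_measure_preimage hB hB', Set.ofPred_exists]
  exact measure_iUnion_le _

theorem measure_forall_exists_mem_le (h : IsPoissonPointProcess X lam P) {m : ℕ}
    {B : Fin m → Set ℝ} (hB : ∀ j, MeasurableSet (B j)) (hB' : ∀ j, volume (B j) < ∞)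
    (hdisj : Pairwise (Function.onFun Disjoint B)) :
    P {ω | ∀ j, ∃ i, X i ω ∈ B j} ≤ ∏ j, (lam * volume (B j)) := by
  have hindep := (h.count_indep m B hB hdisj).measure_inter_preimage_eq_mul Finset.univ
    (sets := fun _ => {0}ᶜ) (fun _ _ => .of_discrete)
  calc P {ω | ∀ j, ∃ i, X i ω ∈ B j}
      = P (⋂ j ∈ Finset.univ, pointCount X (B j) ⁻¹' {0}ᶜ) := by
        congr 1
        ext ω
        simp only [Set.mem_ofPred_eq, Finset.mem_univ, Set.iInter_true, Set.mem_iInter,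
          Set.mem_preimage, pointCount_ne_zero_iff]
    _ = ∏ j, P (pointCount X (B j) ⁻¹' {0}ᶜ) := hindep
    _ ≤ ∏ j, (lam * volume (B j)) := by
        refine Finset.prod_le_prod' fun j _ => ?_
        refine le_of_eq_of_le ?_ (h.measure_exists_mem_le (hB j) (hB' j))
        congr 1
        ext ω
        exact pointCount_ne_zero_iff

theorem ae_exists_gt (h : IsPoissonPointProcess X lam P) (hlam : 0 < lam) :
    ∀ᵐ ω ∂P, ∀ a : ℝ, ∃ i, a < X i ω := by
  suffices ∀ a : ℕ, ∀ᵐ ω ∂P, ∃ i, (a : ℝ) < X i ω by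
    filter_upwards [ae_all_iff.2 this] with ω hω a
    obtain ⟨n, hn⟩ := exists_nat_gt a
    exact (hω n).imp fun i hi => hn.trans hi
  intro a
  rw [ae_iff]
  -- The void probability of a window of length `T` tends to zero as `T` grows.
  have hbound : ∀ T : ℕ, P {ω | ¬∃ i, (a : ℝ) < X i ω} ≤
      ENNReal.ofReal (Real.exp (-(lam * T))) := by
    intro T
    have hlaw := h.count_law (Set.Ioc a (a + T)) measurableSet_Ioc (by simp)
    have hvol : (volume (Set.Ioc (a : ℝ) (a + T))).toNNReal = T := by simp
    calc P {ω | ¬∃ i, (a : ℝ) < X i ω}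
        ≤ P {ω | pointCount X (Set.Ioc (a : ℝ) (a + T)) ω ∈ ({0} : Set ℕ∞)} := by
          refine measure_mono fun ω hω => ?_
          by_contra hne
          obtain ⟨i, hi⟩ := pointCount_ne_zero_iff.1 hne
          exact hω ⟨i, hi.1⟩
      _ = poissonMeasure (lam * T) ((↑) ⁻¹' ({0} : Set ℕ∞)) := by
          rw [← hvol, ← Measure.map_apply (f := ((↑) : ℕ → ℕ∞)) Measurable.of_discrete .of_discrete,
            ← hlaw.map_eq, Measure.map_apply_of_aemeasurable hlaw.aemeasurable .of_discrete]
          rfl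
      _ = ENNReal.ofReal (Real.exp (-(lam * T))) := by
          have : ((↑) ⁻¹' ({0} : Set ℕ∞) : Set ℕ) = {0} := by ext; simp
          rw [this, poissonMeasure_singleton]
          simp
  refine le_antisymm (ge_of_tendsto' (f := fun T : ℕ => ENNReal.ofReal (Real.exp (-(lam * T))))
    (x := atTop) ?_ hbound) zero_le
  rw [← ENNReal.ofReal_zero]
  refine ENNReal.tendsto_ofReal (Real.tendsto_exp_neg_atTop_nhds_zero.comp ?_)
  exact tendsto_natCast_atTop_atTop.const_mul_atTop (NNReal.coe_pos.2 hlam)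

end IsPoissonPointProcess

/-- Fubini for the product law: `Θ` may be frozen at a constant value. -/
theorem ae_mem_of_indepFun {Ω α β : Type*} [MeasurableSpace Ω] [MeasurableSpace α]
    [MeasurableSpace β] {P : Measure Ω} [IsProbabilityMeasure P] {Θ : Ω → α} {Y : Ω → β}
    (hΘ : Measurable Θ) (hY : Measurable Y) (h : IndepFun Θ Y P) {s : Set (α × β)}
    (hs : MeasurableSet s) (H : ∀ᵐ ω' ∂P, ∀ᵐ ω ∂P, (Θ ω', Y ω) ∈ s) :
    ∀ᵐ ω ∂P, (Θ ω, Y ω) ∈ s := by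
  have hprod := (indepFun_iff_map_prod_eq_prod_map_map hΘ.aemeasurable hY.aemeasurable).1 h
  have : ∀ᵐ z ∂(P.map fun ω => (Θ ω, Y ω)), z ∈ s := by
    have := Measure.isProbabilityMeasure_map (μ := P) hY.aemeasurable
    rw [hprod]
    refine (Measure.ae_prod_iff_ae_ae (p := fun z => z ∈ s) hs).2 ?_
    have hm : MeasurableSet {x | ∀ᵐ y ∂(P.map Y), (x, y) ∈ s} := by
      have : {x | ∀ᵐ y ∂(P.map Y), (x, y) ∈ s} =
          (fun x => P.map Y (Prod.mk x ⁻¹' sᶜ)) ⁻¹' {0} := by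
        ext x
        simp [ae_iff]
        rfl
      rw [this]
      exact measurable_measure_prodMk_left hs.compl (measurableSet_singleton 0)
    rw [ae_map_iff hΘ.aemeasurable hm]
    filter_upwards [H] with ω' hω'
    exact (ae_map_iff hY.aemeasurable (measurable_prodMk_left hs)).2 hω'
  exact ae_of_ae_map (hΘ.prodMk hY).aemeasurable this

/-! ### Affine relations between points, by discretisation -/

/-- The grid cell `[u / m, (u + 1) / m)`. -/
def gridCell (m : ℕ) (u : ℤ) : Set ℝ := Set.Ico ((u : ℝ) / m) ((u + 1) / m)

theorem mem_gridCell_floor {m : ℕ} (hm : 0 < m) (x : ℝ) : x ∈ gridCell m ⌊(m : ℝ) * x⌋ := by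
  have hm' : (0 : ℝ) < m := Nat.cast_pos.2 hm
  constructor
  · rw [div_le_iff₀ hm', mul_comm]
    exact Int.floor_le _
  · rw [lt_div_iff₀ hm', mul_comm]
    exact Int.lt_floor_add_one _

theorem abs_sub_lt_of_mem_gridCell {m : ℕ} {u : ℤ} {x y : ℝ} (hx : x ∈ gridCell m u)
    (hy : y ∈ gridCell m u) : |x - y| < 1 / m := by
  have : ((u : ℝ) + 1) / m = u / m + 1 / m := add_div _ _ _
  rw [gridCell, Set.mem_Ico, this] at hx hy
  rw [abs_lt]
  constructor <;> linarith [hx.1, hx.2, hy.1, hy.2]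

theorem volume_gridCell (m : ℕ) (u : ℤ) : volume (gridCell m u) = ENNReal.ofReal (1 / m) := by
  rw [gridCell, Real.volume_Ico]
  congr 1
  ring

theorem disjoint_gridCell {m : ℕ} (hm : 0 < m) {u v : ℤ} (h : u ≠ v) :
    Disjoint (gridCell m u) (gridCell m v) := by
  have hm' : (0 : ℝ) < m := Nat.cast_pos.2 hm
  have key : ∀ {u : ℤ} {x : ℝ}, x ∈ gridCell m u → ⌊(m : ℝ) * x⌋ = u := by
    intro u x hx
    rw [gridCell, Set.mem_Ico, div_le_iff₀ hm', lt_div_iff₀ hm'] at hx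
    rw [Int.floor_eq_iff, mul_comm]
    exact hx
  exact Set.disjoint_left.2 fun x hu hv => h ((key hu).symm.trans (key hv))

theorem floor_mem_Icc {m N : ℕ} {x : ℝ} (hx : |x| ≤ N) :
    ⌊(m : ℝ) * x⌋ ∈ Finset.Icc (-(m * N : ℤ)) (m * N) := by
  have hm' : (0 : ℝ) ≤ m := Nat.cast_nonneg m
  obtain ⟨h1, h2⟩ := abs_le.1 hx
  rw [Finset.mem_Icc]
  constructor
  · rw [Int.le_floor]
    push_cast
    nlinarith
  · have : ((⌊(m : ℝ) * x⌋ : ℤ) : ℝ) ≤ ((m * N : ℤ) : ℝ) := by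
      push_cast
      exact (Int.floor_le _).trans (mul_le_mul_of_nonneg_left h2 hm')
    exact_mod_cast this

/-- Two distinct grid cells `u`, `v` and the part outside them of an interval that contains
`a + b x + c y` for all `x` in the cell `u` and `y` in the cell `v`. -/
def affineCells (a b c : ℝ) (m : ℕ) (u v : ℤ) : Fin 3 → Set ℝ :=
  ![gridCell m u, gridCell m v,
    Set.Icc (a + b * (u / m) + c * (v / m) - (|b| + |c|) / m)
      (a + b * (u / m) + c * (v / m) + (|b| + |c|) / m) \ (gridCell m u ∪ gridCell m v)]

theorem measurableSet_affineCells (a b c : ℝ) (m : ℕ) (u v : ℤ) (j : Fin 3) :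
    MeasurableSet (affineCells a b c m u v j) := by
  fin_cases j
  · exact measurableSet_Ico
  · exact measurableSet_Ico
  · exact measurableSet_Icc.diff (measurableSet_Ico.union measurableSet_Ico)

theorem volume_affineCells_le (a b c : ℝ) (m : ℕ) (u v : ℤ) (j : Fin 3) :
    volume (affineCells a b c m u v j) ≤
      ![ENNReal.ofReal (1 / m), ENNReal.ofReal (1 / m), ENNReal.ofReal (2 * (|b| + |c|) / m)] j := by
  fin_cases j
  · exact (volume_gridCell m u).le
  · exact (volume_gridCell m v).le
  · refine (measure_mono Set.sdiff_subset).trans ?_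
    rw [Real.volume_Icc]
    refine le_of_eq ?_
    simp only [Fin.reduceFinMk, Matrix.cons_val]
    congr 1
    ring

theorem pairwise_disjoint_affineCells (a b c : ℝ) {m : ℕ} (hm : 0 < m) {u v : ℤ} (h : u ≠ v) :
    Pairwise (Function.onFun Disjoint (affineCells a b c m u v)) := by
  have h01 := disjoint_gridCell hm h
  have h02 : Disjoint (gridCell m u) (affineCells a b c m u v 2) :=
    Set.disjoint_sdiff_right.mono_left Set.subset_union_left
  have h12 : Disjoint (gridCell m v) (affineCells a b c m u v 2) :=
    Set.disjoint_sdiff_right.mono_left Set.subset_union_right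
  intro i j hij
  fin_cases i <;> fin_cases j
  · exact absurd rfl hij
  · exact h01
  · exact h02
  · exact h01.symm
  · exact absurd rfl hij
  · exact h12
  · exact h02.symm
  · exact h12.symm
  · exact absurd rfl hij

theorem add_mul_add_mul_mem_affineCells {a b c : ℝ} {m : ℕ} {u v : ℤ} {x y z : ℝ}
    (hx : x ∈ gridCell m u) (hy : y ∈ gridCell m v) (hz : z = a + b * x + c * y)
    (hzu : z ∉ gridCell m u) (hzv : z ∉ gridCell m v) : z ∈ affineCells a b c m u v 2 := by
  refine ⟨?_, by simp [hzu, hzv]⟩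
  have key : ∀ (d : ℝ) {w : ℤ} {t : ℝ}, t ∈ gridCell m w → |d * t - d * (w / m)| ≤ |d| / m := by
    intro d w t ht
    have h1 : |t - w / m| ≤ 1 / m := by
      have : ((w : ℝ) + 1) / m = w / m + 1 / m := add_div _ _ _
      rw [gridCell, Set.mem_Ico, this] at ht
      rw [abs_of_nonneg (by linarith [ht.1])]
      linarith [ht.2]
    rw [← mul_sub, abs_mul, div_eq_mul_one_div |d|]
    exact mul_le_mul_of_nonneg_left h1 (abs_nonneg d)
  have hb := abs_le.1 (key b hx)
  have hc := abs_le.1 (key c hy)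
  have e : (|b| + |c|) / (m : ℝ) = |b| / m + |c| / m := add_div _ _ _
  rw [Set.mem_Icc, hz, e]
  constructor <;> linarith [hb.1, hb.2, hc.1, hc.2]

namespace IsPoissonPointProcess

variable {Ω : Type*} [MeasurableSpace Ω] {P : Measure Ω} {X : ℕ → Ω → ℝ} {lam : ℝ≥0}

theorem measure_affineCells_le (h : IsPoissonPointProcess X lam P) (a b c : ℝ) {m : ℕ}
    (hm : 0 < m) {u v : ℤ} (huv : u ≠ v) :
    P {ω | ∀ j, ∃ i, X i ω ∈ affineCells a b c m u v j} ≤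
      ENNReal.ofReal (lam ^ 3 * (2 * (|b| + |c|)) / m ^ 3) := by
  have hvol := volume_affineCells_le a b c m u v
  refine (h.measure_forall_exists_mem_le (measurableSet_affineCells a b c m u v)
    (fun j => (hvol j).trans_lt ?_) (pairwise_disjoint_affineCells a b c hm huv)).trans ?_
  · fin_cases j <;> exact ENNReal.ofReal_lt_top
  · refine (Finset.prod_le_prod' fun j _ => mul_le_mul_right (hvol j) _).trans (le_of_eq ?_)
    rw [Fin.prod_univ_three]
    simp only [Matrix.cons_val]
    rw [← ENNReal.ofReal_coe_nnreal, ← ENNReal.ofReal_mul (by positivity),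
      ← ENNReal.ofReal_mul (by positivity), ← ENNReal.ofReal_mul (by positivity),
      ← ENNReal.ofReal_mul (by positivity)]
    congr 1
    ring

/-- On a grid of mesh `1 / m ≤ δ` the three points avoid each other's cells, so the counts in
`affineCells` are independent. There are `O(m ^ 2)` pairs of cells, each contributing `O(1 / m ^
3)`: the total is `O(1 / m)`. -/
theorem measure_separated_affine_eq_zero (h : IsPoissonPointProcess X lam P) (a b c : ℝ)
    (i j k : ℕ) (N : ℕ) {δ : ℝ} (hδ : 0 < δ) :
    P {ω | |X i ω| ≤ N ∧ |X j ω| ≤ N ∧ δ ≤ |X i ω - X j ω| ∧ δ ≤ |X k ω - X i ω| ∧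
      δ ≤ |X k ω - X j ω| ∧ X k ω = a + b * X i ω + c * X j ω} = 0 := by
  set K : ℝ := lam ^ 3 * (2 * (|b| + |c|)) with hK
  have hK0 : 0 ≤ K := by positivity
  have hbound : ∀ᶠ m : ℕ in atTop,
      P {ω | |X i ω| ≤ N ∧ |X j ω| ≤ N ∧ δ ≤ |X i ω - X j ω| ∧ δ ≤ |X k ω - X i ω| ∧
        δ ≤ |X k ω - X j ω| ∧ X k ω = a + b * X i ω + c * X j ω} ≤
      ENNReal.ofReal ((2 * N + 1) ^ 2 * K / m) := by
    have hlim : Tendsto (fun m : ℕ => 1 / (m : ℝ)) atTop (𝓝 0) := tendsto_one_div_atTop_nhds_zero_nat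
    filter_upwards [hlim.eventually_le_const hδ, eventually_gt_atTop 0] with m hmδ hm
    set T := Finset.Icc (-(m * N : ℤ)) (m * N)
    have hm1 : (1 : ℝ) ≤ m := by exact_mod_cast hm
    calc _ ≤ P (⋃ p ∈ T.offDiag, {ω | ∀ l, ∃ i, X i ω ∈ affineCells a b c m p.1 p.2 l}) := by
          refine measure_mono ?_
          rintro ω ⟨hi, hj, hij, hki, hkj, he⟩
          have ne_cell : ∀ {x y : ℝ} {w : ℤ}, δ ≤ |x - y| → y ∈ gridCell m w →
              x ∉ gridCell m w := fun hd hy hx =>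
            (abs_sub_lt_of_mem_gridCell hx hy).not_ge (hmδ.trans hd)
          have hci := mem_gridCell_floor hm (X i ω)
          have hcj := mem_gridCell_floor hm (X j ω)
          refine Set.mem_biUnion (x := (⌊(m : ℝ) * X i ω⌋, ⌊(m : ℝ) * X j ω⌋)) ?_ ?_
          · refine Finset.mem_coe.2 (Finset.mem_offDiag.2 ⟨floor_mem_Icc hi, floor_mem_Icc hj, ?_⟩)
            intro (e : ⌊(m : ℝ) * X i ω⌋ = ⌊(m : ℝ) * X j ω⌋)
            exact ne_cell hij hcj (e ▸ hci)
          · intro l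
            fin_cases l
            · exact ⟨i, hci⟩
            · exact ⟨j, hcj⟩
            · exact ⟨k, add_mul_add_mul_mem_affineCells hci hcj he (ne_cell hki hci)
                (ne_cell hkj hcj)⟩
      _ ≤ ∑ p ∈ T.offDiag, ENNReal.ofReal (K / m ^ 3) := by
          refine (measure_biUnion_finset_le _ _).trans (Finset.sum_le_sum fun p hp => ?_)
          exact h.measure_affineCells_le a b c hm (Finset.mem_offDiag.1 hp).2.2
      _ = ENNReal.ofReal (T.offDiag.card * (K / m ^ 3)) := by
          rw [Finset.sum_const, nsmul_eq_mul, ENNReal.ofReal_mul (Nat.cast_nonneg _),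
            ENNReal.ofReal_natCast]
      _ ≤ ENNReal.ofReal ((2 * N + 1) ^ 2 * K / m) := by
          refine ENNReal.ofReal_le_ofReal ?_
          have hcard : (T.card : ℝ) ≤ (2 * N + 1) * m := by
            have : T.card = 2 * (m * N) + 1 := by
              rw [Int.card_Icc]
              omega
            rw [this]
            push_cast
            nlinarith
          have hoff : (T.offDiag.card : ℝ) ≤ ((2 * N + 1) * m) ^ 2 := by
            have : T.offDiag.card ≤ T.card ^ 2 := by
              rw [Finset.offDiag_card, sq]
              exact Nat.sub_le _ _
            calc (T.offDiag.card : ℝ) ≤ (T.card : ℝ) ^ 2 := by exact_mod_cast this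
              _ ≤ _ := by gcongr
          calc (T.offDiag.card : ℝ) * (K / m ^ 3)
              ≤ ((2 * N + 1) * m) ^ 2 * (K / m ^ 3) := by gcongr
            _ = (2 * N + 1) ^ 2 * K / m := by
              field_simp
  refine le_antisymm (ge_of_tendsto ?_ hbound) zero_le
  rw [← ENNReal.ofReal_zero]
  exact ENNReal.tendsto_ofReal (tendsto_const_div_atTop_nhds_zero_nat _)

/-- Injectivity separates the three points, so countably many bounds `N` and gaps `1 / (n + 1)`
exhaust the event. -/
theorem ae_ne_affine (h : IsPoissonPointProcess X lam P) (a b c : ℝ) {i j k : ℕ}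
    (hij : i ≠ j) (hki : k ≠ i) (hkj : k ≠ j) :
    ∀ᵐ ω ∂P, X k ω ≠ a + b * X i ω + c * X j ω := by
  have hnull : ∀ N n : ℕ, ∀ᵐ ω ∂P, ¬(|X i ω| ≤ N ∧ |X j ω| ≤ N ∧
      1 / ((n : ℝ) + 1) ≤ |X i ω - X j ω| ∧ 1 / ((n : ℝ) + 1) ≤ |X k ω - X i ω| ∧
      1 / ((n : ℝ) + 1) ≤ |X k ω - X j ω| ∧ X k ω = a + b * X i ω + c * X j ω) := by
    intro N n
    rw [ae_iff]
    simp only [not_not]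
    exact h.measure_separated_affine_eq_zero a b c i j k N Nat.one_div_pos_of_nat
  filter_upwards [h.injective, ae_all_iff.2 fun N => ae_all_iff.2 (hnull N)] with ω hinj hω he
  have hpos : ∀ {p q : ℕ}, p ≠ q → 0 < |X p ω - X q ω| := fun hpq =>
    abs_pos.2 (sub_ne_zero.2 fun e => hpq (hinj e))
  obtain ⟨N, hN⟩ := exists_nat_ge (max |X i ω| |X j ω|)
  obtain ⟨n, hn⟩ := exists_nat_one_div_lt (lt_min (hpos hij) (lt_min (hpos hki) (hpos hkj)))
  rw [lt_min_iff, lt_min_iff] at hn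
  exact hω N n ⟨(le_max_left _ _).trans hN, (le_max_right _ _).trans hN, hn.1.le, hn.2.1.le,
    hn.2.2.le, he⟩

end IsPoissonPointProcess

/-! ### Almost sure properties of the Poisson landscape -/

theorem exists_lt_mem_support_of_lt_heightSup {𝓛 : Measure ℝ≥0} {r : ℝ≥0}
    (hr : (r : ℝ≥0∞) < heightSup 𝓛) : ∃ h ∈ 𝓛.support, r < h := by
  simp only [heightSup, lt_iSup_iff, ENNReal.coe_lt_coe] at hr
  obtain ⟨h, hh, hrh⟩ := hr
  exact ⟨h, hh, hrh⟩

/-- The support has full measure, and a point of it at the supremum would be its maximum, which is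
not charged. -/
theorem ae_lt_heightSup {𝓛 : Measure ℝ≥0}
    (hmax : ∀ m : ℝ≥0, IsGreatest 𝓛.support m → 𝓛 {m} = 0) :
    ∀ᵐ h : ℝ≥0 ∂𝓛, (h : ℝ≥0∞) < heightSup 𝓛 := by
  have hle : ∀ h ∈ 𝓛.support, (h : ℝ≥0∞) ≤ heightSup 𝓛 := fun h hh =>
    le_iSup₂ (f := fun (h : ℝ≥0) (_ : h ∈ 𝓛.support) => (h : ℝ≥0∞)) h hh
  by_cases hS : ∃ m ∈ 𝓛.support, (m : ℝ≥0∞) = heightSup 𝓛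
  · obtain ⟨m, hm, hmS⟩ := hS
    have hgreatest : IsGreatest 𝓛.support m :=
      ⟨hm, fun h hh => ENNReal.coe_le_coe.1 (hmS ▸ hle h hh)⟩
    filter_upwards [Measure.support_mem_ae (μ := 𝓛), measure_eq_zero_iff_ae_notMem.1
      (hmax m hgreatest)] with h hh hne
    refine lt_of_le_of_ne (hle h hh) fun e => hne ?_
    exact ENNReal.coe_injective (e.trans hmS.symm)
  · filter_upwards [Measure.support_mem_ae (μ := 𝓛)] with h hh
    exact lt_of_le_of_ne (hle h hh) fun e => hS ⟨h, hh, e⟩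

/-- A tie of nonzero slopes makes the base of `c` an affine function of the base of `d`. -/
theorem base_eq_of_slopeBetween_eq {p c d : HalfPlane} (hc : p.1 < c.1) (hd : p.1 < d.1)
    (h : slopeBetween p c = slopeBetween p d) (h0 : slopeBetween p c ≠ 0) :
    c.1 = (1 - ((c.2 : ℝ) - p.2) / (d.2 - p.2)) * p.1 + ((c.2 : ℝ) - p.2) / (d.2 - p.2) * d.1 := by
  have e1 := slopeBetween_mul hc
  have e2 := slopeBetween_mul hd
  rw [h] at e1 h0
  have hd' := (sub_pos.2 hd).ne'
  rw [← e1, ← e2]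
  field_simp
  ring

theorem IsPoissonBuildingProcess.ae_finite_base_mem {Ω : Type*} [MeasurableSpace Ω] {P : Measure Ω}
    {X : ℕ → Ω → ℝ} {M : ℕ → Ω → ℝ≥0} {lam : ℝ≥0} {𝓛 : Measure ℝ≥0}
    (h : IsPoissonBuildingProcess X M lam 𝓛 P) :
    ∀ᵐ ω ∂P, ∀ a b : ℝ, {c | c ∈ landscape X M ω ∧ a ≤ c.1 ∧ c.1 ≤ b}.Finite := by
  have hloc := ae_all_iff.2 fun n : ℕ =>
    h.bases.ae_finite_mem (B := Set.Icc (-n : ℝ) n) measurableSet_Icc (by simp)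
  filter_upwards [hloc] with ω hloc a b
  obtain ⟨N, hN⟩ := exists_nat_ge (max |a| |b|)
  refine ((hloc N).image fun i => (X i ω, M i ω)).subset ?_
  rintro c ⟨⟨i, rfl⟩, hc1, hc2⟩
  have h1 := (neg_abs_le a).trans hc1
  have h2 := hc2.trans (le_abs_self b)
  have h3 := (le_max_left _ _).trans hN
  have h4 := (le_max_right _ _).trans hN
  exact ⟨i, ⟨by linarith, by linarith⟩, rfl⟩

theorem IsPoissonBuildingProcess.ae_height_lt {Ω : Type*} [MeasurableSpace Ω] {P : Measure Ω}
    {X : ℕ → Ω → ℝ} {M : ℕ → Ω → ℝ≥0} {lam : ℝ≥0} {𝓛 : Measure ℝ≥0}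
    (h : IsPoissonBuildingProcess X M lam 𝓛 P)
    (hmax : ∀ m : ℝ≥0, IsGreatest 𝓛.support m → 𝓛 {m} = 0) :
    ∀ᵐ ω ∂P, ∀ c ∈ landscape X M ω, (c.2 : ℝ≥0∞) < heightSup 𝓛 := by
  have hall : ∀ᵐ ω ∂P, ∀ i, (M i ω : ℝ≥0∞) < heightSup 𝓛 := ae_all_iff.2 fun i => by
    refine ae_of_ae_map (p := fun y : ℝ≥0 => (y : ℝ≥0∞) < heightSup 𝓛)
      (h.measurable i).aemeasurable ?_
    rw [(h.marks_law i).map_eq]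
    exact ae_lt_heightSup hmax
  filter_upwards [hall] with ω hω
  rintro c ⟨i, rfl⟩
  exact hω i

namespace IsPoissonBuildingProcess

variable {Ω : Type*} [MeasurableSpace Ω] {P : Measure Ω} [IsProbabilityMeasure P]
  {X : ℕ → Ω → ℝ} {M : ℕ → Ω → ℝ≥0} {lam : ℝ≥0} {𝓛 : Measure ℝ≥0}

theorem tsum_measure_gt_lt_top (h : IsPoissonBuildingProcess X M lam 𝓛 P)
    (hmean : ∫⁻ h, (h : ℝ≥0∞) ∂𝓛 < ∞) {ε : ℝ} (hε : 0 < ε) :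
    ∑' n : ℕ, 𝓛 {y | ε * n < y} < ∞ := by
  let _ : MeasureSpace Ω := ⟨P⟩
  have hint : Integrable fun ω => (M 0 ω : ℝ) / ε := by
    refine Integrable.div_const (c := ε) ⟨?_, ?_⟩
    · exact (h.measurable 0).coe_nnreal_real.aestronglyMeasurable
    · rw [hasFiniteIntegral_iff_enorm]
      have := (h.marks_law 0).map_eq ▸ lintegral_map (μ := P) (f := fun y : ℝ≥0 => (y : ℝ≥0∞))
        (by fun_prop) (h.measurable 0)
      rw [this] at hmean
      refine lt_of_eq_of_lt (lintegral_congr fun ω => ?_) hmean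
      simp
  convert tsum_prob_mem_Ioi_lt_top hint (fun ω => by positivity) with n
  have hset : MeasurableSet {y : ℝ≥0 | ε * n < y} :=
    measurableSet_lt measurable_const measurable_coe_nnreal_real
  rw [← (h.marks_law 0).measure_eq hset]
  congr 1
  ext ω
  simp only [Set.mem_ofPred_eq, Set.mem_Ioi, lt_div_iff₀ hε, mul_comm]

/-- Borel–Cantelli: cutting the half line into unit intervals bounds the expected number by `lam`
times a tail sum of `𝓛`, finite because the mean is. -/
theorem ae_finite_mul_base_lt_height (h : IsPoissonBuildingProcess X M lam 𝓛 P)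
    (hmean : ∫⁻ h, (h : ℝ≥0∞) ∂𝓛 < ∞) {ε : ℝ} (hε : 0 < ε) :
    ∀ᵐ ω ∂P, {i | 0 ≤ X i ω ∧ ε * X i ω < M i ω}.Finite := by
  refine ae_finite_setOfPred_mem (s := fun i => {ω | 0 ≤ X i ω ∧ ε * X i ω < M i ω}) (ne_of_lt ?_)
  have hset : ∀ n : ℕ, MeasurableSet {y : ℝ≥0 | ε * n < y} := fun n =>
    measurableSet_lt measurable_const measurable_coe_nnreal_real
  calc ∑' i, P {ω | 0 ≤ X i ω ∧ ε * X i ω < M i ω}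
      ≤ ∑' i, ∑' n : ℕ, P (X i ⁻¹' Set.Ico n (n + 1) ∩ M i ⁻¹' {y | ε * n < y}) := by
        refine ENNReal.tsum_le_tsum fun i => le_trans (measure_mono ?_) (measure_iUnion_le _)
        rintro ω ⟨h0, hlt⟩
        refine Set.mem_iUnion.2 ⟨⌊X i ω⌋₊, ⟨Nat.floor_le h0, Nat.lt_floor_add_one _⟩, ?_⟩
        exact (mul_le_mul_of_nonneg_left (Nat.floor_le h0) hε.le).trans_lt hlt
    _ = ∑' i, ∑' n : ℕ, P (X i ⁻¹' Set.Ico n (n + 1)) * 𝓛 {y | ε * n < y} := by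
        congr with i
        congr with n
        have hind : IndepFun (X i) (M i) P :=
          h.marks_indep_bases.comp (measurable_pi_apply i) (measurable_pi_apply i)
        rw [hind.measure_inter_preimage_eq_mul _ _ measurableSet_Ico (hset n)]
        congr 1
        exact (h.marks_law i).measure_eq (hset n)
    _ = ∑' n : ℕ, ∑' i, P (X i ⁻¹' Set.Ico n (n + 1)) * 𝓛 {y | ε * n < y} := ENNReal.tsum_comm
    _ = ∑' n : ℕ, lam * 𝓛 {y | ε * n < y} := by
        congr with n
        rw [ENNReal.tsum_mul_right, h.bases.tsum_measure_preimage measurableSet_Ico (by simp)]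
        simp
    _ < ∞ := by
        rw [ENNReal.tsum_mul_left]
        exact ENNReal.mul_lt_top ENNReal.coe_lt_top (h.tsum_measure_gt_lt_top hmean hε)

theorem ae_finite_slope_ge (h : IsPoissonBuildingProcess X M lam 𝓛 P)
    (hmean : ∫⁻ h, (h : ℝ≥0∞) ∂𝓛 < ∞) :
    ∀ᵐ ω ∂P, ∀ (p : HalfPlane) (δ : ℝ), 0 < δ →
      {c | c ∈ landscape X M ω ∧ p.1 < c.1 ∧ δ ≤ slopeBetween p c}.Finite := by
  have hlin := ae_all_iff.2 fun n : ℕ =>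
    h.ae_finite_mul_base_lt_height hmean (ε := 1 / ((n : ℝ) + 1)) Nat.one_div_pos_of_nat
  have hloc := ae_all_iff.2 fun n : ℕ =>
    h.bases.ae_finite_mem (B := Set.Icc (-n : ℝ) n) measurableSet_Icc (by simp)
  filter_upwards [hlin, hloc] with ω hlin hloc p δ hδ
  -- Beyond `2 * |p.1|` the distance to `p` is at least half the base, so slope at least `δ` from
  -- `p` forces height at least `δ / 2` times the base.
  obtain ⟨n, hn⟩ := exists_nat_one_div_lt (half_pos hδ)
  obtain ⟨N, hN⟩ := exists_nat_ge (2 * |p.1|)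
  refine (((hlin n).union (hloc N)).image fun i => (X i ω, M i ω)).subset ?_
  rintro c ⟨⟨i, rfl⟩, hc1, hc2⟩
  refine ⟨i, ?_, rfl⟩
  have hle := (le_div_iff₀ (sub_pos.2 hc1)).1 hc2
  dsimp only at hc1 hle
  have hp := abs_le.1 (le_refl |p.1|)
  have hp2 : (0 : ℝ) ≤ p.2 := p.2.2
  have hp0 := abs_nonneg p.1
  by_cases hb : X i ω ≤ N
  · exact Or.inr ⟨by linarith, hb⟩
  · have hX0 : 0 < X i ω := by linarith
    refine Or.inl ⟨hX0.le, (mul_lt_mul_of_pos_right hn hX0).trans_le ?_⟩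
    nlinarith

theorem ae_exists_mem_height_mem (h : IsPoissonBuildingProcess X M lam 𝓛 P) {I : Set ℕ}
    (hI : I.Infinite) {B : Set ℝ≥0} (hB : MeasurableSet B) (hB0 : 𝓛 B ≠ 0) :
    ∀ᵐ ω ∂P, ∃ i ∈ I, M i ω ∈ B := by
  have : IsProbabilityMeasure 𝓛 := by
    rw [← (h.marks_law 0).map_eq]
    exact Measure.isProbabilityMeasure_map (h.measurable 0).aemeasurable
  have hlt : 𝓛 Bᶜ < 1 := by
    rw [prob_compl_eq_one_sub hB]
    exact ENNReal.sub_lt_self ENNReal.one_ne_top one_ne_zero hB0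
  rw [ae_iff]
  refine le_antisymm (ge_of_tendsto' (ENNReal.tendsto_pow_atTop_nhds_zero_of_lt_one hlt)
    fun n => ?_) zero_le
  obtain ⟨s, hsI, rfl⟩ := hI.exists_subset_card_eq n
  calc P {ω | ¬∃ i ∈ I, M i ω ∈ B} ≤ P (⋂ i ∈ s, M i ⁻¹' Bᶜ) := by
        refine measure_mono fun ω hω => ?_
        simp only [Set.mem_iInter]
        exact fun i hi hiB => hω ⟨i, hsI hi, hiB⟩
    _ = ∏ i ∈ s, P (M i ⁻¹' Bᶜ) :=
        h.marks_indep.measure_inter_preimage_eq_mul s fun _ _ => hB.compl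
    _ = 𝓛 Bᶜ ^ s.card := by
        rw [← Finset.prod_const]
        exact Finset.prod_congr rfl fun i _ => (h.marks_law i).measure_eq hB.compl

/-- With the bases frozen, the indices of bases beyond `a` form a fixed infinite set, and the i.i.d.
marks along it cannot all avoid `B`. -/
theorem ae_exists_base_gt_height_mem (h : IsPoissonBuildingProcess X M lam 𝓛 P) (hlam : 0 < lam)
    {B : Set ℝ≥0} (hB : MeasurableSet B) (hB0 : 𝓛 B ≠ 0) (a : ℝ) :
    ∀ᵐ ω ∂P, ∃ i, a < X i ω ∧ M i ω ∈ B := by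
  have hs : MeasurableSet {z : (ℕ → ℝ) × (ℕ → ℝ≥0) | ∃ i, a < z.1 i ∧ z.2 i ∈ B} := by
    rw [Set.ofPred_exists]
    refine MeasurableSet.iUnion fun i => MeasurableSet.inter ?_ ?_
    · exact measurableSet_lt measurable_const ((measurable_pi_apply i).comp measurable_fst)
    · exact ((measurable_pi_apply i).comp measurable_snd) hB
  refine ae_mem_of_indepFun (measurable_pi_lambda _ h.bases.measurable)
    (measurable_pi_lambda _ h.measurable) h.marks_indep_bases hs ?_
  filter_upwards [h.bases.ae_exists_gt hlam] with ω' hω'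
  refine (h.ae_exists_mem_height_mem (I := {i | a < X i ω'}) (fun hfin => ?_) hB hB0).mono
    fun ω ⟨i, hi⟩ => ⟨i, hi⟩
  obtain ⟨b, hb⟩ := (hfin.image fun i => X i ω').bddAbove
  obtain ⟨i, hi⟩ := hω' (max a b)
  exact (hb ⟨i, (le_max_left _ _).trans_lt hi, rfl⟩).not_gt ((le_max_right _ _).trans_lt hi)

theorem ae_exists_high (h : IsPoissonBuildingProcess X M lam 𝓛 P) (hlam : 0 < lam) :
    ∀ᵐ ω ∂P, ∀ r : ℝ≥0, (r : ℝ≥0∞) < heightSup 𝓛 → ∀ a : ℝ,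
      ∃ c ∈ landscape X M ω, a < c.1 ∧ r < c.2 := by
  -- Rational heights and integer bases keep the exceptional events countable.
  have hall : ∀ᵐ ω ∂P, ∀ (q : ℚ) (n : ℕ), 𝓛 (Set.Ioi (Real.toNNReal q)) ≠ 0 →
      ∃ i, (n : ℝ) < X i ω ∧ M i ω ∈ Set.Ioi (Real.toNNReal q) :=
    ae_all_iff.2 fun q => ae_all_iff.2 fun n => by
      by_cases hq : 𝓛 (Set.Ioi (Real.toNNReal q)) = 0
      · exact Eventually.of_forall fun ω hne => absurd hq hne
      · exact (h.ae_exists_base_gt_height_mem hlam measurableSet_Ioi hq n).mono fun ω hω _ => hω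
  filter_upwards [hall] with ω hω r hr a
  obtain ⟨y, hy, hry⟩ := exists_lt_mem_support_of_lt_heightSup hr
  obtain ⟨q, -, hrq, hqy⟩ := (NNReal.lt_iff_exists_rat_btwn r y).1 hry
  obtain ⟨n, hn⟩ := exists_nat_ge a
  obtain ⟨i, hi1, hi2⟩ := hω q n
    ((Measure.mem_support_iff_forall y).1 hy _ (Ioi_mem_nhds hqy)).ne'
  exact ⟨_, ⟨i, rfl⟩, hn.trans_lt hi1, hrq.trans hi2⟩

theorem ae_base_ne_affine (h : IsPoissonBuildingProcess X M lam 𝓛 P)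
    {a b c : (ℕ → ℝ≥0) → ℝ} (ha : Measurable a) (hb : Measurable b) (hc : Measurable c)
    {i j k : ℕ} (hij : i ≠ j) (hki : k ≠ i) (hkj : k ≠ j) :
    ∀ᵐ ω ∂P, X k ω ≠ a (fun l => M l ω) + b (fun l => M l ω) * X i ω +
      c (fun l => M l ω) * X j ω := by
  have hs : MeasurableSet {z : (ℕ → ℝ≥0) × (ℕ → ℝ) |
      z.2 k ≠ a z.1 + b z.1 * z.2 i + c z.1 * z.2 j} :=
    (measurableSet_eq_fun (by fun_prop) (by fun_prop)).compl
  exact ae_mem_of_indepFun (measurable_pi_lambda _ h.measurable)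
    (measurable_pi_lambda _ h.bases.measurable) h.marks_indep_bases.symm hs
    (Eventually.of_forall fun ω' => h.bases.ae_ne_affine (a fun l => M l ω')
      (b fun l => M l ω') (c fun l => M l ω') hij hki hkj)

theorem ae_noSlopeTie_of_mem (h : IsPoissonBuildingProcess X M lam 𝓛 P) :
    ∀ᵐ ω ∂P, ∀ p ∈ landscape X M ω, NoSlopeTie (landscape X M ω) p := by
  have hall : ∀ᵐ ω ∂P, ∀ i j k, i ≠ j → k ≠ i → k ≠ j →
      X k ω ≠ 0 + (1 - ((M k ω : ℝ) - M i ω) / (M j ω - M i ω)) * X i ω +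
        ((M k ω : ℝ) - M i ω) / (M j ω - M i ω) * X j ω := by
    simp only [eventually_imp_distrib_left, ae_all_iff]
    intro i j k hij hki hkj
    exact h.ae_base_ne_affine (a := fun _ => 0)
      (b := fun m => 1 - ((m k : ℝ) - m i) / (m j - m i))
      (c := fun m => ((m k : ℝ) - m i) / (m j - m i))
      measurable_const (by fun_prop) (by fun_prop) hij hki hkj
  filter_upwards [hall] with ω hω
  rintro _ ⟨i, rfl⟩ _ ⟨k, rfl⟩ _ ⟨j, rfl⟩ hk hj hkj he
  by_contra h0
  refine hω i j k ?_ ?_ ?_ ((base_eq_of_slopeBetween_eq hk hj he h0).trans ?_)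
  · rintro rfl
    exact lt_irrefl _ hj
  · rintro rfl
    exact lt_irrefl _ hk
  · rintro rfl
    exact hkj rfl
  · rw [zero_add]

theorem ae_noSlopeTie (h : IsPoissonBuildingProcess X M lam 𝓛 P) {p : Ω → HalfPlane}
    (hp : Measurable p) (hindep : IndepFun p (fun ω i => (X i ω, M i ω)) P) :
    ∀ᵐ ω ∂P, NoSlopeTie (landscape X M ω) (p ω) := by
  have hall : ∀ᵐ ω ∂P, ∀ j k, k ≠ j →
      X k ω ≠ (1 - ((M k ω : ℝ) - (p ω).2) / (M j ω - (p ω).2)) * (p ω).1 +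
        ((M k ω : ℝ) - (p ω).2) / (M j ω - (p ω).2) * X j ω := by
    simp only [eventually_imp_distrib_left, ae_all_iff]
    intro j k hkj
    have hs : MeasurableSet {z : HalfPlane × (ℕ → ℝ × ℝ≥0) |
        (z.2 k).1 ≠ (1 - (((z.2 k).2 : ℝ) - z.1.2) / ((z.2 j).2 - z.1.2)) * z.1.1 +
        (((z.2 k).2 : ℝ) - z.1.2) / ((z.2 j).2 - z.1.2) * (z.2 j).1} :=
      (measurableSet_eq_fun (by fun_prop) (by fun_prop)).compl
    refine ae_mem_of_indepFun hp
      (measurable_pi_lambda _ fun i => (h.bases.measurable i).prodMk (h.measurable i)) hindep hs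
      (Eventually.of_forall fun ω' => ?_)
    -- Here `p` is frozen and only two bases are related; a spare index with coefficient zero fits
    -- this into the relation between three.
    obtain ⟨i, hi⟩ := Infinite.exists_notMem_finset ({j, k} : Finset ℕ)
    rw [Finset.mem_insert, Finset.mem_singleton, not_or] at hi
    have := h.ae_base_ne_affine
      (a := fun m => (1 - ((m k : ℝ) - (p ω').2) / (m j - (p ω').2)) * (p ω').1)
      (b := fun _ => 0) (c := fun m => ((m k : ℝ) - (p ω').2) / (m j - (p ω').2))
      (by fun_prop) measurable_const (by fun_prop) hi.1 (Ne.symm hi.2) hkj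
    simpa using this
  filter_upwards [hall] with ω hω
  rintro _ ⟨k, rfl⟩ _ ⟨j, rfl⟩ hk hj hkj he
  by_contra h0
  refine hω j k ?_ (base_eq_of_slopeBetween_eq hk hj he h0)
  rintro rfl
  exact hkj rfl

theorem ae_isGenericLandscape (h : IsPoissonBuildingProcess X M lam 𝓛 P) (hlam : 0 < lam)
    (hmean : ∫⁻ h, (h : ℝ≥0∞) ∂𝓛 < ∞)
    (hmax : ∀ m : ℝ≥0, IsGreatest 𝓛.support m → 𝓛 {m} = 0) :
    ∀ᵐ ω ∂P, IsGenericLandscape (landscape X M ω) (heightSup 𝓛) := by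
  filter_upwards [h.ae_finite_slope_ge hmean, h.ae_finite_base_mem, h.ae_exists_high hlam,
    h.ae_height_lt hmax, h.ae_noSlopeTie_of_mem] with ω h1 h2 h3 h4 h5
  exact ⟨h1, h2, h3, h4, h5⟩

end IsPoissonBuildingProcess

theorem mainTheorem3 {Ω : Type*} [MeasurableSpace Ω] (P : Measure Ω) [IsProbabilityMeasure P]
    (lam : ℝ≥0) (hlam : 0 < lam)
    (𝓛 : Measure ℝ≥0) [IsProbabilityMeasure 𝓛]
    (hmean : ∫⁻ h, (h : ℝ≥0∞) ∂𝓛 < ∞)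
    (hmax : ∀ m : ℝ≥0, IsGreatest 𝓛.support m → 𝓛 {m} = 0)
    (X : ℕ → Ω → ℝ) (M : ℕ → Ω → ℝ≥0)
    (hL : IsPoissonBuildingProcess X M lam 𝓛 P)
    (p₀ : Ω → HalfPlane) (hp₀ : Measurable p₀)
    (hindep : IndepFun p₀ (fun ω i => (X i ω, M i ω)) P)
    (hp₀S : ∀ᵐ ω ∂P, ((p₀ ω).2 : ℝ≥0∞) < heightSup 𝓛) :
    ∀ᵐ ω ∂P,
      (∀ n, IsBlockingBuilding (landscape X M ω)
        (blockageSeq (landscape X M ω) (p₀ ω) n)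
        (blockageSeq (landscape X M ω) (p₀ ω) (n + 1))) ∧
      Tendsto (fun n => (blockageHeight (landscape X M ω) (p₀ ω) n : ℝ≥0∞)) atTop
        (𝓝 (heightSup 𝓛)) ∧
      Tendsto (blockageSlopeSeq (landscape X M ω) (p₀ ω)) atTop (𝓝 0) := by
  filter_upwards [hL.ae_isGenericLandscape hlam hmean hmax, hL.ae_noSlopeTie hp₀ hindep, hp₀S]
    with ω h1 h2 h3
  exact h1.blockage h3 h2
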